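/- Let $K$ be a field, $\mathbb T$ the set of terms (monic monomials) in the variables $x=(x_1,\dots,x_n)$, and $\mathcal O\subset\mathbb T$ a finite order ideal, i.e. a finite set of terms closed under taking divisors. Let $\partial\mathcal O=\{x_i\tau\mid \tau\in\mathcal O,\ 1\le i\le n\}\setminus\mathcal O$ be its border, with its terms labelled $\beta_1,\dots,\beta_m$ so that $\deg\beta_1\le\dots\le\deg\beta_m$ (ties in any order). For a commutative ring $A$, a $\partial\mathcal O$-marked set in $A[x]$ is a family $F=(f_\beta)_{\beta\in\partial\mathcal O}$ of polynomials $f_\beta=\beta-\sum_{\sigma\in\mathcal O}c_{\beta\sigma}\sigma$ with $c_{\beta\sigma}\in A$. It is a $\partial\mathcal O$-marked basis if $A[x]=(F)\oplus\langle N\rangle_A$ as $A$-modules, where $N$ is the set of terms divisible by no element of $\partial\mathcal O$ (so $N=\mathcal O$ when $\mathcal O\neq\emptyset$). Let $\mathrm{Mb}_{\partial\mathcal O}$ be the functor from Noetherian commutative $K$-algebras to sets that sends $A$ to the set of ideals of $A[x]$ generated by a $\partial\mathcal O$-marked basis, and $\phi:A\to A'$ to the map $I\mapsto I\,A'[x]$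 (extension of ideals along $A[x]\to A'[x]$). Given a marked set $F$, a reduction step replaces a polynomial $g$ by $g-c\,\eta f_{\beta_i}$, where $\eta\beta_i$ is a term of the support of $g$ with coefficient $c$ and no $\beta_j$ with $j>i$ divides $\eta\beta_i$. The polynomial $g$ reduces to $h$ if $h$ is obtained from $g$ by finitely many (possibly zero) such steps. A polynomial is $\mathcal O$-reduced if its support is contained in $\mathcal O$. Let $C=\{C_{\beta\sigma}\mid\beta\in\partial\mathcal O,\ \sigma\in\mathcal O\}$ be indeterminates and let $b_\beta=\beta-\sum_{\sigma\in\mathcal O}C_{\beta\sigma}\sigma\in K[C][x]$; these polynomials form the generic $\partial\mathcal O$-marked set. A pair $(\beta,\beta')$ of terms of $\partial\mathcal O$ is a neighbour couple if $\beta=x_j\beta'$ for some $j$ or $x_i\beta=x_j\beta'$ for some $i,j$. Put $S(b_\beta,b_{\beta'})=\eta b_\beta-\eta' b_{\beta'}$, where $\eta\beta=\eta'\beta'=\mathrm{lcm}(\beta,\beta')$. **Theorem 3.4.** For every neighbour couple $(\beta,\beta')$ of terms of $\partial\mathcal O$, the polynomial $S(b_\beta,b_{\beta'})$ reduces, with respect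 to the generic $\partial\mathcal O$-marked set, to exactly one $\mathcal O$-reduced polynomial $h_{\beta\beta'}\in K[C][x]$. Let $\mathfrak B\subset K[C]$ be the ideal generated by the coefficients in $K[C]$ of all the polynomials $h_{\beta\beta'}$, viewed as polynomials in $x$. Then $\mathrm{Mb}_{\partial\mathcal O}$ is the functor of points of $\mathrm{Spec}(K[C]/\mathfrak B)$: it is naturally isomorphic to the functor $A\mapsto \mathrm{Hom}_{\mathrm{Spec}\,K}(\mathrm{Spec}\,A,\ \mathrm{Spec}(K[C]/\mathfrak B))$ on Noetherian $K$-algebras. -/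

import Mathlib

open CategoryTheory

universe u

namespace MarkedBases

/-- The terms (monic monomials) in the variables `x_0, …, x_{n-1}`, given by their exponents.
Products of terms are sums, and `τ` divides `σ` exactly when `τ ≤ σ`. -/
abbrev Term (n : ℕ) := Fin n →₀ ℕ

/-- A set of terms is an order ideal if it contains all divisors of its elements. -/
def IsOrderIdeal {n : ℕ} (O : Set (Term n)) : Prop :=
  ∀ σ τ : Term n, τ ∈ O → σ ≤ τ → σ ∈ O

/-- The border `∂O = {x_i τ | τ ∈ O} \ O`. -/
noncomputable def border {n : ℕ} (O : Finset (Term n)) : Finset (Term n) :=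
  ((Finset.univ ×ˢ O).image fun p : Fin n × Term n => Finsupp.single p.1 1 + p.2) \ O

/-- The cone `{τ α | τ ∈ T}` of the term `α` by the set of terms `T`. -/
def cone {n : ℕ} (T : Set (Term n)) (α : Term n) : Set (Term n) :=
  {γ | ∃ τ ∈ T, γ = τ + α}

/-- The terms of the monomial ideal generated by `H`. -/
def termsOfIdeal {n : ℕ} (H : Finset (Term n)) : Set (Term n) :=
  {γ | ∃ α ∈ H, α ≤ γ}

/-- Reduction structures: finitely many head terms, each with a multiplicative set (an order ideal)
and a finite tail set, such that the cones cover the terms of the ideal generated by the head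
terms and each tail set avoids the cone of its head term. -/
structure ReductionStructure (n : ℕ) where
  head : Finset (Term n)
  tail : head → Finset (Term n)
  mult : head → Set (Term n)
  mult_orderIdeal : ∀ α, IsOrderIdeal (mult α)
  iUnion_cone : ⋃ α : head, cone (mult α) α = termsOfIdeal head
  tail_disjoint : ∀ α : head, Disjoint (tail α : Set (Term n)) (cone (mult α) α)

section Marked

variable {n : ℕ} (J : ReductionStructure n) {A : Type*} [CommRing A]

/-- `F` is a `head`-marked set: `F α` is monic marked with head term `α` and all other terms of its
support lie in the tail set of `α`. -/
def IsMarkedSet (F : J.head → MvPolynomial (Fin n) A) : Prop :=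
  ∀ α : J.head, (F α).coeff (α : Term n) = 1 ∧
    ∀ γ ∈ (F α).support, γ ≠ (α : Term n) → γ ∈ J.tail α

/-- The `A`-module `⟨T⟩_A` generated by a set `T` of terms. -/
noncomputable def termSpan (A : Type*) [CommRing A] {n : ℕ} (T : Set (Term n)) :
    Submodule A (MvPolynomial (Fin n) A) :=
  Submodule.span A ((fun γ => MvPolynomial.monomial γ (1 : A)) '' T)

/-- `F` is a `head`-marked basis: a marked set such that `A[x]` is the direct sum, as an
`A`-module, of the ideal `(F)` and the span of the terms outside the ideal generated by `head`. -/
def IsMarkedBasis (F : J.head → MvPolynomial (Fin n) A) : Prop :=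
  IsMarkedSet J F ∧
    IsCompl ((Ideal.span (Set.range F)).restrictScalars A) (termSpan A (termsOfIdeal J.head)ᶜ)

/-- One step of the reduction relation of `F`: a term `γ = η α` of the support of `g`, in the cone
of the head term `α`, is eliminated by subtracting `c η F_α`, with `c` the coefficient of `γ`. -/
def ReductionStep (F : J.head → MvPolynomial (Fin n) A) (g h : MvPolynomial (Fin n) A) : Prop :=
  ∃ α : J.head, ∃ η ∈ J.mult α, η + (α : Term n) ∈ g.support ∧
    h = g - MvPolynomial.monomial η (g.coeff (η + (α : Term n))) * F α

/-- `g` reduces to `h` in finitely many (possibly zero) steps. -/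
def Reduces (F : J.head → MvPolynomial (Fin n) A) (g h : MvPolynomial (Fin n) A) : Prop :=
  Relation.ReflTransGen (ReductionStep J F) g h

end Marked

/-- A polynomial is `O`-reduced if its support is contained in `O`. -/
def IsReduced {n : ℕ} {A : Type*} [CommRing A] (O : Finset (Term n))
    (h : MvPolynomial (Fin n) A) : Prop :=
  h.support ⊆ O

/-- The `S`-polynomial `η f - η' f'` of marked polynomials `f`, `f'` with head terms `α`, `α'`,
where `η α = η' α' = lcm(α, α')`. -/
noncomputable def sPoly {n : ℕ} {A : Type*} [CommRing A] (α α' : Term n)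
    (f f' : MvPolynomial (Fin n) A) : MvPolynomial (Fin n) A :=
  MvPolynomial.monomial (α ⊔ α' - α) 1 * f - MvPolynomial.monomial (α ⊔ α' - α') 1 * f'

/-- `(α, α')` is a neighbour couple: `α = x_j α'`, or `x_i α = x_j α'`. -/
def IsNeighbour {n : ℕ} (α α' : Term n) : Prop :=
  (∃ j : Fin n, α = Finsupp.single j 1 + α') ∨
    ∃ i j : Fin n, Finsupp.single i 1 + α = Finsupp.single j 1 + α'

/-- The border reduction structure of the finite order ideal `O`, for a labelling
`β_0, …, β_{m-1}` of the terms of `∂O`: the head terms are those of `∂O`, all tail sets are `O`, and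
`μ` is multiplicative for `β_i` when no `β_j` with `j > i` divides `β_i μ`. -/
noncomputable abbrev borderRS {n m : ℕ} (O : Finset (Term n)) (hO : IsOrderIdeal (O : Set (Term n)))
    (β : Fin m ≃ border O) : ReductionStructure n where
  head := border O
  tail := fun _ => O
  mult := fun α => {μ | ∀ j : Fin m, β.symm α < j → ¬ (β j : Term n) ≤ (α : Term n) + μ}
  mult_orderIdeal := fun α σ τ hτ hστ j hj hle =>
    hτ j hj (hle.trans (by gcongr))
  iUnion_cone := by
    ext γ
    simp only [Set.mem_iUnion, cone, termsOfIdeal, Set.mem_ofPred_eq]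
    constructor
    · rintro ⟨α, τ, -, rfl⟩
      exact ⟨α, α.2, le_add_self⟩
    · rintro ⟨α, hα, hle⟩
      have hne : (Finset.univ.filter fun i : Fin m => (β i : Term n) ≤ γ).Nonempty :=
        ⟨β.symm ⟨α, hα⟩, by simpa using hle⟩
      obtain ⟨i, hi, hmax⟩ := Finset.exists_max_image _ id hne
      have hi' : (β i : Term n) ≤ γ := by simpa using hi
      refine ⟨β i, γ - β i, ?_, (tsub_add_cancel_of_le hi').symm⟩
      intro j hj hle
      rw [add_tsub_cancel_of_le hi'] at hle
      have := hmax j (by simpa using hle)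
      simp only [Equiv.symm_apply_apply] at hj
      exact absurd this (not_le.mpr hj)
  tail_disjoint := by
    intro α
    rw [Set.disjoint_left]
    rintro γ hγ ⟨τ, -, rfl⟩
    have h1 : (α : Term n) ∈ O := by simpa using hO (α : Term n) _ hγ le_add_self
    have h2 := α.2
    simp only [border, Finset.mem_sdiff] at h2
    exact h2.2 h1

/-- The generic marked set on head terms `H` with all tail sets equal to `O`: the polynomials
`g_τ = τ - ∑_{σ ∈ O} C_{τ σ} σ` with coefficients in `K[C]`, `C = {C_{τ σ} | τ ∈ H, σ ∈ O}`. -/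
noncomputable def genericMarkedSet (K : Type*) [Field K] {n : ℕ} (H O : Finset (Term n)) (τ : H) :
    MvPolynomial (Fin n) (MvPolynomial (H × O) K) :=
  MvPolynomial.monomial (τ : Term n) 1 -
    ∑ σ : O, MvPolynomial.monomial (σ : Term n) (MvPolynomial.X (τ, σ))

/-- The ideal of `K[C]` generated by the `x`-coefficients of the `O`-reduced polynomials to which
the `S`-polynomials of the neighbour couples of the generic `∂O`-marked set reduce. -/
noncomputable def borderIdeal (K : Type*) [Field K] {n m : ℕ} (O : Finset (Term n))
    (hO : IsOrderIdeal (O : Set (Term n))) (β : Fin m ≃ border O) :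
    Ideal (MvPolynomial (border O × O) K) :=
  Ideal.span {c | ∃ r s : border O, IsNeighbour (r : Term n) (s : Term n) ∧
    ∃ h, Reduces (borderRS O hO β) (genericMarkedSet K (border O) O)
        (sPoly (r : Term n) (s : Term n)
          (genericMarkedSet K (border O) O r) (genericMarkedSet K (border O) O s)) h ∧
      IsReduced O h ∧ ∃ γ : Term n, c = h.coeff γ}

section BaseChange

variable {n : ℕ} {A B : Type*} [CommRing A] [CommRing B] (φ : A →+* B)

lemma map_mem_termSpan (T : Set (Term n)) {p : MvPolynomial (Fin n) A}
    (hp : p ∈ termSpan A T) : MvPolynomial.map φ p ∈ termSpan B T := by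
  induction hp using Submodule.span_induction with
  | mem x hx =>
    obtain ⟨γ, hγ, rfl⟩ := hx
    exact Submodule.subset_span ⟨γ, hγ, by simp⟩
  | zero => simp
  | add x y _ _ hx hy => rw [map_add]; exact add_mem hx hy
  | smul a x _ hx =>
    rw [MvPolynomial.smul_eq_C_mul, map_mul, MvPolynomial.map_C, ← MvPolynomial.smul_eq_C_mul]
    exact Submodule.smul_mem _ _ hx

lemma isCompl_map (T : Set (Term n)) (I : Ideal (MvPolynomial (Fin n) A))
    (h : IsCompl (I.restrictScalars A) (termSpan A T)) :
    IsCompl ((I.map (MvPolynomial.map φ)).restrictScalars B) (termSpan B T) := by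
  constructor
  · let e : MvPolynomial (Fin n) A →ₗ[A] MvPolynomial (Fin n) A :=
      Submodule.projection _ _ h.symm
    have he1 : ∀ p ∈ I, e p = 0 := fun p hp =>
      (Submodule.projection_apply_eq_zero_iff h.symm).2 hp
    have he2 : ∀ p ∈ termSpan A T, e p = p := fun p hp =>
      Submodule.projection_apply_left h.symm ⟨p, hp⟩
    let e' : MvPolynomial (Fin n) B →ₗ[B] MvPolynomial (Fin n) B :=
      (MvPolynomial.basisMonomials (Fin n) B).constr B
        fun γ => MvPolynomial.map φ (e (MvPolynomial.monomial γ 1))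
    have hm : ∀ γ, e' (MvPolynomial.monomial γ 1) =
        MvPolynomial.map φ (e (MvPolynomial.monomial γ 1)) := fun γ => by
      have := (MvPolynomial.basisMonomials (Fin n) B).constr_basis B
        (fun γ => MvPolynomial.map φ (e (MvPolynomial.monomial γ 1))) γ
      simpa using this
    have key : ∀ p, e' (MvPolynomial.map φ p) = MvPolynomial.map φ (e p) := by
      intro p
      induction p using MvPolynomial.induction_on' with
      | monomial γ a =>
        have h1 : MvPolynomial.monomial γ a = a • MvPolynomial.monomial γ (1 : A) := by
          simp [MvPolynomial.smul_monomial]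
        have h2 : MvPolynomial.monomial γ (φ a) = φ a • MvPolynomial.monomial γ (1 : B) := by
          simp [MvPolynomial.smul_monomial]
        rw [MvPolynomial.map_monomial, h2, map_smul, hm, h1, map_smul,
          MvPolynomial.smul_eq_C_mul, MvPolynomial.smul_eq_C_mul, map_mul, MvPolynomial.map_C]
      | add p q hp hq => simp only [map_add, hp, hq]
    have hI : ∀ p ∈ I.map (MvPolynomial.map φ), e' p = 0 := by
      intro p hp
      have hb : ∀ (q : MvPolynomial (Fin n) B) (g : MvPolynomial (Fin n) A), g ∈ I →
          e' (q * MvPolynomial.map φ g) = 0 := by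
        intro q g hg
        induction q using MvPolynomial.induction_on' with
        | monomial γ b =>
          have h1 : MvPolynomial.monomial γ b * MvPolynomial.map φ g =
              b • MvPolynomial.map φ (MvPolynomial.monomial γ 1 * g) := by
            rw [map_mul, MvPolynomial.map_monomial, map_one, ← smul_mul_assoc,
              MvPolynomial.smul_monomial, smul_eq_mul, mul_one]
          rw [h1, map_smul, key, he1 _ (I.mul_mem_left _ hg), map_zero, smul_zero]
        | add p q hp hq => rw [add_mul, map_add, hp, hq, add_zero]
      rw [Ideal.map] at hp
      induction hp using Submodule.span_induction with
      | mem x hx =>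
        obtain ⟨g, hg, rfl⟩ := hx
        simpa using hb 1 g hg
      | zero => simp
      | add x y _ _ hx hy => rw [map_add, hx, hy, add_zero]
      | smul a x hx ih =>
        clear ih
        induction hx using Submodule.span_induction generalizing a with
        | mem x hx =>
          obtain ⟨g, hg, rfl⟩ := hx
          exact hb a g hg
        | zero => simp
        | add x y _ _ hx hy => rw [smul_add, map_add, hx, hy, add_zero]
        | smul c x _ hx => rw [smul_smul]; exact hx _
    have hT : ∀ p ∈ termSpan B T, e' p = p := by
      intro p hp
      induction hp using Submodule.span_induction with
      | mem x hx =>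
        obtain ⟨γ, hγ, rfl⟩ := hx
        change e' (MvPolynomial.monomial γ 1) = _
        rw [hm, he2 _ (Submodule.subset_span ⟨γ, hγ, rfl⟩)]
        simp
      | zero => simp
      | add x y _ _ hx hy => rw [map_add, hx, hy]
      | smul a x _ hx => rw [map_smul, hx]
    rw [Submodule.disjoint_def]
    intro p hp hp'
    rw [← hT p hp']
    exact hI p hp
  · rw [codisjoint_iff, eq_top_iff]
    intro p _
    induction p using MvPolynomial.induction_on' with
    | monomial γ b =>
      have h0 : MvPolynomial.monomial γ (1 : A) ∈ I.restrictScalars A ⊔ termSpan A T := by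
        rw [h.sup_eq_top]; trivial
      obtain ⟨p, hp, q, hq, hpq⟩ := Submodule.mem_sup.1 h0
      have h1 : MvPolynomial.monomial γ b =
          b • MvPolynomial.map φ p + b • MvPolynomial.map φ q := by
        rw [← smul_add, ← map_add, hpq]
        simp [MvPolynomial.smul_monomial]
      rw [h1]
      exact Submodule.add_mem_sup
        (Submodule.smul_mem _ _ (Ideal.mem_map_of_mem (MvPolynomial.map φ) hp))
        (Submodule.smul_mem _ _ (map_mem_termSpan φ T hq))
    | add p q hp hq => exact add_mem (hp trivial) (hq trivial)

lemma IsMarkedSet.map {J : ReductionStructure n} {F : J.head → MvPolynomial (Fin n) A}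
    (h : IsMarkedSet J F) : IsMarkedSet J fun α => MvPolynomial.map φ (F α) := by
  intro α
  refine ⟨by rw [MvPolynomial.coeff_map, (h α).1, map_one], fun γ hγ hne => ?_⟩
  exact (h α).2 γ (MvPolynomial.support_map_subset φ _ hγ) hne

lemma map_span_range {J : ReductionStructure n} (F : J.head → MvPolynomial (Fin n) A) :
    (Ideal.span (Set.range F)).map (MvPolynomial.map φ) =
      Ideal.span (Set.range fun α => MvPolynomial.map φ (F α)) := by
  rw [Ideal.map_span, ← Set.range_comp]
  rfl

lemma IsMarkedBasis.map {J : ReductionStructure n} {F : J.head → MvPolynomial (Fin n) A}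
    (h : IsMarkedBasis J F) : IsMarkedBasis J fun α => MvPolynomial.map φ (F α) := by
  refine ⟨h.1.map φ, ?_⟩
  rw [← map_span_range]
  exact isCompl_map φ _ _ h.2

lemma ideal_map_id (I : Ideal (MvPolynomial (Fin n) A)) :
    I.map (MvPolynomial.map (RingHom.id A)) = I := by
  have h : MvPolynomial.map (σ := Fin n) (RingHom.id A) = RingHom.id _ :=
    RingHom.ext fun p => MvPolynomial.map_id p
  rw [h, Ideal.map_id]

lemma ideal_map_comp {B' : Type*} [CommRing B'] (ψ : B →+* B')
    (I : Ideal (MvPolynomial (Fin n) A)) :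
    I.map (MvPolynomial.map (ψ.comp φ)) =
      (I.map (MvPolynomial.map φ)).map (MvPolynomial.map ψ) := by
  rw [Ideal.map_map]
  congr 1
  exact RingHom.ext fun p => (MvPolynomial.map_map φ ψ p).symm

end BaseChange

/-- The category of Noetherian (commutative) `K`-algebras. -/
abbrev NoethAlg (K : Type u) [Field K] :=
  ObjectProperty.FullSubcategory fun A : CommAlgCat.{u} K => IsNoetherianRing A

/-- The ideals of `A[x]` generated by a `head`-marked basis. -/
abbrev MarkedBasisIdeals {n : ℕ} (J : ReductionStructure n) (A : Type u) [CommRing A] : Type u :=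
  {I : Ideal (MvPolynomial (Fin n) A) //
    ∃ F : J.head → MvPolynomial (Fin n) A, IsMarkedBasis J F ∧ I = Ideal.span (Set.range F)}

/-- Extension of ideals along `A[x] → A'[x]`, on ideals generated by marked bases. -/
noncomputable def MarkedBasisIdeals.extend {n : ℕ} {J : ReductionStructure n} {A A' : Type u}
    [CommRing A] [CommRing A'] (φ : A →+* A') (I : MarkedBasisIdeals J A) :
    MarkedBasisIdeals J A' :=
  ⟨I.1.map (MvPolynomial.map φ), by
    obtain ⟨F, hF, hI⟩ := I.2
    exact ⟨_, hF.map φ, by rw [hI, map_span_range]⟩⟩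

/-- The marked basis functor: it sends a Noetherian `K`-algebra `A` to the set of ideals of `A[x]`
generated by a `head`-marked basis, and a morphism `A → A'` to extension of ideals along
`A[x] → A'[x]`. -/
noncomputable def markedBasisFunctor (K : Type u) [Field K] {n : ℕ} (J : ReductionStructure n) :
    NoethAlg K ⥤ Type u where
  obj A := MarkedBasisIdeals J A.obj
  map f := TypeCat.ofHom (MarkedBasisIdeals.extend f.hom.hom.toRingHom)
  map_id _ := ConcreteCategory.hom_ext _ _ fun I => Subtype.ext (ideal_map_id I.1)
  map_comp f g := ConcreteCategory.hom_ext _ _ fun I =>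
    Subtype.ext (ideal_map_comp f.hom.hom.toRingHom g.hom.hom.toRingHom I.1)

/-- The functor of points of a `K`-scheme `X`, restricted to Noetherian `K`-algebras:
`A ↦ Hom_{Spec K}(Spec A, X)`. -/
noncomputable abbrev functorOfPoints (K : Type u) [Field K]
    (X : Over (AlgebraicGeometry.Spec (CommRingCat.of K))) : NoethAlg K ⥤ Type u :=
  ObjectProperty.ι _ ⋙ (AlgebraicGeometry.algSpec (CommRingCat.of K)).rightOp ⋙ yoneda.obj X

/-- The affine scheme `Spec (K[C] / 𝔅)` over `Spec K`. -/
noncomputable def borderMarkedScheme (K : Type u) [Field K] {n m : ℕ} (O : Finset (Term n))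
    (hO : IsOrderIdeal (O : Set (Term n))) (β : Fin m ≃ border O) :
    Over (AlgebraicGeometry.Spec (CommRingCat.of K)) :=
  (AlgebraicGeometry.algSpec (CommRingCat.of K)).obj
    (Opposite.op (CommAlgCat.of K (MvPolynomial (border O × O) K ⧸ borderIdeal K O hO β)))

end MarkedBases

namespace MarkedBases

open MvPolynomial

/-! ### Spans of sets of terms, described by coefficients -/

section TermSpan

variable {n : ℕ} {A : Type*} [CommRing A] {T U : Set (Term n)}

/-! Write `⟨O⟩` for the span of `O`. For a neighbour couple the heads cancel in the S-polynomial and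
each tail is multiplied by at most one variable, so its support lies in `O ∪ ∂O`. On such
polynomials the labelling by degree leaves only reduction steps `g - c f_τ` with `τ` itself a border
term, and these do not interfere because tails lie in `O`. Hence the reduced form is unique: it is
the value of the linear map `remainder`, which commutes with base change. So a specialization of `C`
kills `𝔅` exactly when the specialized remainders vanish (`borderIdeal_le_ker_iff`).

This vanishing characterizes marked bases (`isMarkedBasis_ofCoeffs_iff`). It is necessary because
the remainders lie in `(F) ∩ ⟨O⟩`. For sufficiency, multiply by `x_i` and take remainders: this
gives endomorphisms of `⟨O⟩`, which commute when the neighbour remainders vanish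
(`NeighboursVanish.mulVar_comm`). If `O` is nonempty, then `⟨O⟩` becomes an `A[x]`-module, and `p ↦
p · 1` is a retraction onto `⟨O⟩` killing `(F)` (`NeighboursVanish.exists_retraction`), so the sum
is direct; that it is everything holds for any marked set.

Finally, a marked basis is determined by its ideal, so the ideals in question correspond to
`K`-algebra maps `K[C]/𝔅 → A`, that is, to points of the spectrum. -/

lemma monomial_mem_termSpan {γ : Term n} (h : γ ∈ T) (a : A) :
    monomial γ a ∈ termSpan A T := by
  have : monomial γ a = a • monomial γ (1 : A) := by simp [smul_monomial]
  rw [this]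
  exact Submodule.smul_mem _ _ (Submodule.subset_span ⟨γ, h, rfl⟩)

lemma mem_termSpan_iff {p : MvPolynomial (Fin n) A} :
    p ∈ termSpan A T ↔ ∀ γ, γ ∉ T → p.coeff γ = 0 := by
  constructor
  · intro hp γ hγ
    induction hp using Submodule.span_induction with
    | mem x hx =>
      obtain ⟨δ, hδ, rfl⟩ := hx
      rw [coeff_monomial, if_neg]
      rintro rfl
      exact hγ hδ
    | zero => simp
    | add x y _ _ hx hy => rw [coeff_add, hx, hy, add_zero]
    | smul a x _ hx => rw [coeff_smul, hx, smul_zero]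
  · intro h
    rw [p.as_sum]
    refine Submodule.sum_mem _ fun γ hγ => monomial_mem_termSpan ?_ _
    by_contra hne
    exact mem_support_iff.1 hγ (h γ hne)

lemma isReduced_iff_mem_termSpan {O : Finset (Term n)} {p : MvPolynomial (Fin n) A} :
    IsReduced O p ↔ p ∈ termSpan A (O : Set (Term n)) := by
  rw [mem_termSpan_iff]
  constructor
  · intro h γ hγ
    by_contra hne
    exact hγ (h (mem_support_iff.2 hne))
  · intro h γ hγ
    by_contra hne
    exact mem_support_iff.1 hγ (h γ hne)

lemma termSpan_mono (h : T ⊆ U) : termSpan A T ≤ termSpan A U :=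
  Submodule.span_mono (Set.image_mono h)

lemma termSpan_univ : termSpan A (Set.univ : Set (Term n)) = ⊤ :=
  eq_top_iff.2 fun _ _ => mem_termSpan_iff.2 fun γ hγ => absurd (Set.mem_univ γ) hγ

end TermSpan

/-! ### Combinatorics of order ideals and borders -/

section Border

variable {n : ℕ} {O : Finset (Term n)}

lemma notMem_of_mem_border {γ : Term n} (h : γ ∈ border O) : γ ∉ O := by
  simp only [border, Finset.mem_sdiff] at h
  exact h.2

lemma single_add_mem {γ : Term n} (hγ : γ ∈ O) (i : Fin n) :
    Finsupp.single i 1 + γ ∈ O ∨ Finsupp.single i 1 + γ ∈ border O := by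
  by_cases h : Finsupp.single i 1 + γ ∈ O
  · exact Or.inl h
  · refine Or.inr ?_
    simp only [border, Finset.mem_sdiff]
    exact ⟨Finset.mem_image.2 ⟨(i, γ), by simpa using hγ, rfl⟩, h⟩

lemma exists_eq_single_add_of_mem_border {γ : Term n} (h : γ ∈ border O) :
    ∃ i, ∃ τ ∈ O, γ = Finsupp.single i 1 + τ := by
  simp only [border, Finset.mem_sdiff, Finset.mem_image] at h
  obtain ⟨⟨⟨i, τ⟩, hτ, rfl⟩, -⟩ := h
  exact ⟨i, τ, by simpa using hτ, rfl⟩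

lemma exists_eq_single_add {γ : Term n} (h : γ ≠ 0) :
    ∃ (i : Fin n) (τ : Term n), γ = Finsupp.single i 1 + τ := by
  obtain ⟨i, hi⟩ := Finsupp.ne_iff.1 h
  refine ⟨i, γ - Finsupp.single i 1, (add_tsub_cancel_of_le ?_).symm⟩
  rw [Finsupp.single_le_iff]
  exact Nat.one_le_iff_ne_zero.2 hi

lemma term_induction {P : Term n → Prop} (zero : P 0)
    (step : ∀ (i : Fin n) (τ : Term n), P τ → P (Finsupp.single i 1 + τ)) (γ : Term n) : P γ := by
  induction hd : Finsupp.degree γ generalizing γ with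
  | zero =>
    rw [Finsupp.degree_eq_zero_iff] at hd
    exact hd ▸ zero
  | succ d ih =>
    have hne : γ ≠ 0 := by
      rintro rfl
      simp at hd
    obtain ⟨i, τ, rfl⟩ := exists_eq_single_add hne
    refine step i τ (ih τ ?_)
    rw [map_add, Finsupp.degree_single] at hd
    omega

lemma subset_compl_termsOfIdeal_border (hO : IsOrderIdeal (O : Set (Term n))) :
    (O : Set (Term n)) ⊆ (termsOfIdeal (border O))ᶜ := by
  rintro σ hσ ⟨α, hα, hle⟩
  exact notMem_of_mem_border hα (hO α σ hσ hle)

/-- Starting from `1 ∈ O` and multiplying by one variable at a time, one can leave `O` only through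
the border. For empty `O` the border is empty and this fails. -/
lemma compl_termsOfIdeal_border (hO : IsOrderIdeal (O : Set (Term n))) (h0 : (0 : Term n) ∈ O) :
    (termsOfIdeal (border O))ᶜ = (O : Set (Term n)) := by
  refine Set.Subset.antisymm (fun γ => ?_) (subset_compl_termsOfIdeal_border hO)
  induction γ using term_induction with
  | zero => exact fun _ => h0
  | step i τ ih =>
    intro h
    have hτ : τ ∈ O := ih fun ⟨α, hα, hle⟩ => h ⟨α, hα, hle.trans le_add_self⟩
    exact (single_add_mem hτ i).resolve_right fun hb => h ⟨_, hb, le_rfl⟩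

end Border

/-! ### Border marked sets and the remainder map -/

section Marked

variable {n : ℕ} {O : Finset (Term n)} {A B : Type*} [CommRing A] [CommRing B]

/-- The border marked set `τ - ∑ c_{τ σ} σ` with prescribed coefficients. -/
noncomputable def ofCoeffs (c : border O × O → A) (τ : border O) : MvPolynomial (Fin n) A :=
  monomial (τ : Term n) 1 - ∑ σ : O, monomial (σ : Term n) (c (τ, σ))

lemma sum_monomial_mem_termSpan (d : O → A) :
    ∑ σ : O, monomial (σ : Term n) (d σ) ∈ termSpan A (O : Set (Term n)) :=
  Submodule.sum_mem _ fun σ _ => monomial_mem_termSpan σ.2 _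

lemma coeff_sum_monomial (d : O → A) (σ : O) :
    coeff (σ : Term n) (∑ ρ : O, monomial (ρ : Term n) (d ρ)) = d σ := by
  rw [coeff_sum, Finset.sum_eq_single σ]
  · simp
  · intro ρ _ hne
    rw [coeff_monomial, if_neg fun h => hne (Subtype.ext h)]
  · simp

lemma coeff_ofCoeffs_border (c : border O × O → A) (τ τ' : border O) :
    coeff (τ : Term n) (ofCoeffs c τ') = if τ' = τ then 1 else 0 := by
  rw [ofCoeffs, coeff_sub, coeff_monomial,
    mem_termSpan_iff.1 (sum_monomial_mem_termSpan _) _ (notMem_of_mem_border τ.2), sub_zero]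
  simp only [Subtype.ext_iff]

lemma coeff_ofCoeffs (c : border O × O → A) (τ : border O) (σ : O) :
    coeff (σ : Term n) (ofCoeffs c τ) = -c (τ, σ) := by
  rw [ofCoeffs, coeff_sub, coeff_sum_monomial, coeff_monomial, if_neg, zero_sub]
  intro h
  exact notMem_of_mem_border τ.2 (h ▸ σ.2)

lemma map_ofCoeffs (φ : A →+* B) (c : border O × O → A) (τ : border O) :
    map φ (ofCoeffs c τ) = ofCoeffs (fun x => φ (c x)) τ := by
  simp [ofCoeffs, map_sum]

/-- The polynomials with support in `O ∪ ∂O`. -/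
noncomputable abbrev borderSpan (O : Finset (Term n)) (A : Type*) [CommRing A] :
    Submodule A (MvPolynomial (Fin n) A) :=
  termSpan A ((O : Set (Term n)) ∪ (border O : Set (Term n)))

lemma termSpan_le_borderSpan : termSpan A (O : Set (Term n)) ≤ borderSpan O A :=
  termSpan_mono Set.subset_union_left

lemma ofCoeffs_mem_borderSpan (c : border O × O → A) (τ : border O) :
    ofCoeffs c τ ∈ borderSpan O A :=
  sub_mem (monomial_mem_termSpan (Or.inr τ.2) _)
    (termSpan_le_borderSpan (sum_monomial_mem_termSpan _))

lemma X_mul_mem_borderSpan (i : Fin n) {p : MvPolynomial (Fin n) A}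
    (hp : p ∈ termSpan A (O : Set (Term n))) : X i * p ∈ borderSpan O A := by
  induction hp using Submodule.span_induction with
  | mem x hx =>
    obtain ⟨γ, hγ, rfl⟩ := hx
    simp only [X, monomial_mul, mul_one]
    exact monomial_mem_termSpan (single_add_mem hγ i) _
  | zero => simp
  | add x y _ _ hx hy => rw [mul_add]; exact add_mem hx hy
  | smul a x _ hx => rw [mul_smul_comm]; exact Submodule.smul_mem _ _ hx

/-- The remainder obtained by eliminating all border terms of the support at once. -/
noncomputable def remainder (c : border O × O → A) :
    MvPolynomial (Fin n) A →ₗ[A] MvPolynomial (Fin n) A :=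
  LinearMap.id - ∑ τ : border O, (lcoeff A (τ : Term n)).smulRight (ofCoeffs c τ)

lemma remainder_apply (c : border O × O → A) (p : MvPolynomial (Fin n) A) :
    remainder c p = p - ∑ τ : border O, coeff (τ : Term n) p • ofCoeffs c τ := by
  simp [remainder, LinearMap.sum_apply, lcoeff]

lemma remainder_of_coeff_eq_zero (c : border O × O → A) {p : MvPolynomial (Fin n) A}
    (h : ∀ γ ∈ border O, coeff γ p = 0) : remainder c p = p := by
  rw [remainder_apply, Finset.sum_eq_zero, sub_zero]
  intro τ _
  rw [h τ τ.2, zero_smul]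

lemma remainder_of_mem (c : border O × O → A) {p : MvPolynomial (Fin n) A}
    (h : p ∈ termSpan A (O : Set (Term n))) : remainder c p = p :=
  remainder_of_coeff_eq_zero c fun γ hγ => mem_termSpan_iff.1 h γ (notMem_of_mem_border hγ)

lemma remainder_ofCoeffs (c : border O × O → A) (τ : border O) :
    remainder c (ofCoeffs c τ) = 0 := by
  rw [remainder_apply, Finset.sum_eq_single τ]
  · simp [coeff_ofCoeffs_border]
  · intro τ' _ hne
    rw [coeff_ofCoeffs_border, if_neg hne.symm, zero_smul]
  · simp

/-- One simultaneous pass suffices: subtracting a multiple of `f_τ` changes no border coefficient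
except that of `τ`. -/
lemma remainder_mem (c : border O × O → A) {p : MvPolynomial (Fin n) A}
    (h : p ∈ borderSpan O A) : remainder c p ∈ termSpan A (O : Set (Term n)) := by
  have hB : remainder c p ∈ borderSpan O A := by
    rw [remainder_apply]
    exact sub_mem h (Submodule.sum_mem _ fun τ _ =>
      Submodule.smul_mem _ _ (ofCoeffs_mem_borderSpan c τ))
  refine mem_termSpan_iff.2 fun γ hγ => ?_
  by_cases hb : γ ∈ border O
  · rw [remainder_apply, coeff_sub, coeff_sum, Finset.sum_eq_single ⟨γ, hb⟩]
    · have := coeff_ofCoeffs_border c ⟨γ, hb⟩ ⟨γ, hb⟩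
      rw [if_pos rfl] at this
      rw [coeff_smul, this, smul_eq_mul, mul_one, sub_self]
    · intro τ _ hne
      have := coeff_ofCoeffs_border c ⟨γ, hb⟩ τ
      rw [if_neg hne] at this
      rw [coeff_smul, this, smul_zero]
    · simp
  · exact mem_termSpan_iff.1 hB γ (by rintro (h | h); exacts [hγ h, hb h])

lemma sub_remainder_mem (c : border O × O → A) (p : MvPolynomial (Fin n) A) :
    p - remainder c p ∈ Ideal.span (Set.range (ofCoeffs c)) := by
  rw [remainder_apply, sub_sub_cancel]
  refine Ideal.sum_mem _ fun τ _ => ?_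
  rw [smul_eq_C_mul]
  exact Ideal.mul_mem_left _ _ (Ideal.subset_span ⟨τ, rfl⟩)

/-- The formula never tests whether a coefficient is zero, so it survives specialization; a chain of
reduction steps need not, as `φ` may kill a coefficient. -/
lemma map_remainder (φ : A →+* B) (c : border O × O → A) (p : MvPolynomial (Fin n) A) :
    map φ (remainder c p) = remainder (fun x => φ (c x)) (map φ p) := by
  simp [remainder_apply, map_sum, smul_eq_C_mul, map_ofCoeffs, coeff_map]

/-! ### S-polynomials of neighbour couples -/

lemma map_sPoly (φ : A →+* B) (α α' : Term n) (f f' : MvPolynomial (Fin n) A) :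
    map φ (sPoly α α' f f') = sPoly α α' (map φ f) (map φ f') := by
  simp [sPoly]

lemma sPoly_mem_span (c : border O × O → A) (r s : border O) :
    sPoly (r : Term n) (s : Term n) (ofCoeffs c r) (ofCoeffs c s) ∈
      Ideal.span (Set.range (ofCoeffs c)) :=
  sub_mem (Ideal.mul_mem_left _ _ (Ideal.subset_span ⟨r, rfl⟩))
    (Ideal.mul_mem_left _ _ (Ideal.subset_span ⟨s, rfl⟩))

lemma sPoly_eq_of_eq_add {r s : Term n} {j : Fin n} (h : r = Finsupp.single j 1 + s)
    (f f' : MvPolynomial (Fin n) A) : sPoly r s f f' = f - X j * f' := by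
  have hle : s ≤ r := h ▸ le_add_self
  rw [sPoly, sup_eq_left.2 hle, tsub_self, show r - s = Finsupp.single j 1 by
    rw [h, add_tsub_cancel_right], monomial_zero', C_1, one_mul, X]

lemma sPoly_self (r : Term n) (f : MvPolynomial (Fin n) A) : sPoly r r f f = 0 := by
  simp [sPoly]

lemma sPoly_eq_of_add_eq_add {r s : Term n} {i j : Fin n} (hij : i ≠ j)
    (h : Finsupp.single i 1 + r = Finsupp.single j 1 + s)
    (f f' : MvPolynomial (Fin n) A) : sPoly r s f f' = X i * f - X j * f' := by
  have hsup : r ⊔ s = Finsupp.single i 1 + r := by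
    refine le_antisymm (sup_le le_add_self (h ▸ le_add_self)) fun k => ?_
    have hk := DFunLike.congr_fun h k
    simp only [Finsupp.add_apply, Finsupp.single_apply, Finsupp.sup_apply] at hk ⊢
    by_cases hik : i = k
    · have hjk : j ≠ k := fun h => hij (hik.trans h.symm)
      rw [if_pos hik, if_neg hjk] at hk
      rw [if_pos hik]
      -- In coordinate `i` the equation `h` gives `1 + r i = s i`, so the bound is attained by `s`.
      exact le_sup_of_le_right (by omega)
    · rw [if_neg hik, zero_add]
      exact le_sup_left
  rw [sPoly, hsup, add_tsub_cancel_right, h, add_tsub_cancel_right, X, X]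

/-- The heads cancel, and a variable times a term of `O` lies in `O ∪ ∂O`. This puts the
S-polynomial where `remainder` is a reduced form. -/
lemma sPoly_mem_borderSpan (c : border O × O → A) {r s : border O}
    (h : IsNeighbour (r : Term n) (s : Term n)) :
    sPoly (r : Term n) (s : Term n) (ofCoeffs c r) (ofCoeffs c s) ∈ borderSpan O A := by
  have key : ∀ (τ : border O) (i : Fin n), X i * ofCoeffs c τ -
      monomial (Finsupp.single i 1 + (τ : Term n)) 1 ∈ borderSpan O A := fun τ i => by
    have : X i * ofCoeffs c τ - monomial (Finsupp.single i 1 + (τ : Term n)) 1 =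
        -(X i * ∑ σ : O, monomial (σ : Term n) (c (τ, σ))) := by
      rw [ofCoeffs, mul_sub, X, monomial_mul, mul_one]
      ring
    rw [this]
    exact neg_mem (X_mul_mem_borderSpan i (sum_monomial_mem_termSpan _))
  rcases h with ⟨j, h⟩ | ⟨i, j, h⟩
  · rw [sPoly_eq_of_eq_add h]
    have h1 := sub_mem (ofCoeffs_mem_borderSpan c r) (key s j)
    have h2 : monomial (r : Term n) (1 : A) ∈ borderSpan O A :=
      monomial_mem_termSpan (Or.inr r.2) 1
    rw [← h] at h1
    convert sub_mem h1 h2 using 1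
    ring
  · rcases eq_or_ne i j with rfl | hij
    · obtain rfl : r = s := Subtype.ext (add_left_cancel h)
      rw [sPoly_self]
      exact zero_mem _
    · rw [sPoly_eq_of_add_eq_add hij h]
      have h1 := sub_mem (key r i) (key s j)
      rw [h] at h1
      convert h1 using 1
      ring

end Marked

/-! ### Modules over the polynomial ring from commuting endomorphisms -/

open scoped IsMulCommutative in
/-- Commuting endomorphisms make a module into a module over the polynomial ring, so that a vector
determines an equivariant linear map. -/
lemma exists_equivariant {n : ℕ} {A M : Type*} [CommRing A] [AddCommGroup M] [Module A M]
    (T : Fin n → Module.End A M) (hT : ∀ i j, T i * T j = T j * T i) (v : M) :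
    ∃ ψ : MvPolynomial (Fin n) A →ₗ[A] M, ψ 1 = v ∧ ∀ i p, ψ (X i * p) = T i (ψ p) := by
  let S : Subalgebra A (Module.End A M) := Algebra.adjoin A (Set.range T)
  have hS : IsMulCommutative S := Algebra.isMulCommutative_adjoin A (by
    rintro _ ⟨i, rfl⟩ _ ⟨j, rfl⟩
    exact hT i j)
  let e : MvPolynomial (Fin n) A →ₐ[A] S :=
    aeval fun i => (⟨T i, Algebra.subset_adjoin ⟨i, rfl⟩⟩ : S)
  let e' : MvPolynomial (Fin n) A →ₗ[A] Module.End A M := S.val.toLinearMap ∘ₗ e.toLinearMap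
  refine ⟨(LinearMap.applyₗ v) ∘ₗ e', ?_, fun i p => ?_⟩
  · have : e' 1 = 1 := congrArg S.val (map_one e)
    simp [this]
  · have : e' (X i * p) = T i * e' p := by
      have h1 : e (X i * p) = e (X i) * e p := map_mul e _ _
      have h2 : e (X i) = (⟨T i, Algebra.subset_adjoin ⟨i, rfl⟩⟩ : S) := aeval_X _ _
      rw [h2] at h1
      exact congrArg S.val h1
    simp [this]

/-! ### The criterion for marked bases by commuting multiplications -/

section Criterion

variable {n : ℕ} {O : Finset (Term n)} {A : Type*} [CommRing A]

/-- The remainders of the `S`-polynomials of all neighbour couples vanish. -/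
def NeighboursVanish (c : border O × O → A) : Prop :=
  ∀ r s : border O, IsNeighbour (r : Term n) (s : Term n) →
    remainder c (sPoly (r : Term n) (s : Term n) (ofCoeffs c r) (ofCoeffs c s)) = 0

variable {c : border O × O → A}

lemma remainder_monomial_border (τ : border O) :
    remainder c (monomial (τ : Term n) 1) = monomial (τ : Term n) 1 - ofCoeffs c τ := by
  rw [remainder_apply, Finset.sum_eq_single τ]
  · simp
  · intro τ' _ hne
    rw [coeff_monomial, if_neg fun h => hne (Subtype.ext h.symm), zero_smul]
  · simp

lemma NeighboursVanish.remainder_X_mul_single (h : NeighboursVanish c) {r s : border O}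
    {j : Fin n} (hrs : (r : Term n) = Finsupp.single j 1 + (s : Term n)) :
    remainder c (X j * ofCoeffs c s) = 0 := by
  have := h r s (Or.inl ⟨j, hrs⟩)
  rwa [sPoly_eq_of_eq_add hrs, map_sub, remainder_ofCoeffs, zero_sub, neg_eq_zero] at this

lemma NeighboursVanish.remainder_X_mul_eq (h : NeighboursVanish c) {r s : border O}
    {i j : Fin n} (hij : i ≠ j)
    (hrs : Finsupp.single i 1 + (r : Term n) = Finsupp.single j 1 + (s : Term n)) :
    remainder c (X i * ofCoeffs c r) = remainder c (X j * ofCoeffs c s) := by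
  have := h r s (Or.inr ⟨i, j, hrs⟩)
  rwa [sPoly_eq_of_add_eq_add hij hrs, map_sub, sub_eq_zero] at this

lemma remainder_X_mul_remainder_of_mem {γ : Term n} (hγ : γ ∈ O) (j : Fin n) :
    remainder c (X j * remainder c (monomial γ 1)) =
      remainder c (monomial (Finsupp.single j 1 + γ) 1) := by
  rw [remainder_of_mem c (monomial_mem_termSpan (T := (O : Set (Term n))) hγ 1), X, monomial_mul,
    mul_one]

/-- The last term is the error made by reducing `τ` before multiplying by `x_j`; the neighbour
conditions control it. -/
lemma remainder_X_mul_remainder_of_border (τ : border O) (j : Fin n) :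
    remainder c (X j * remainder c (monomial (τ : Term n) 1)) =
      remainder c (monomial (Finsupp.single j 1 + (τ : Term n)) 1) -
        remainder c (X j * ofCoeffs c τ) := by
  rw [remainder_monomial_border, mul_sub, map_sub]
  congr 2
  rw [X, monomial_mul, mul_one]

/-- Multiplication by the variables, followed by taking remainders, commutes on terms of `O`. -/
lemma NeighboursVanish.comm_monomial (h : NeighboursVanish c) (hO : IsOrderIdeal (O : Set (Term n)))
    {σ : Term n} (hσ : σ ∈ O) (i j : Fin n) :
    remainder c (X i * remainder c (X j * monomial σ 1)) =
      remainder c (X j * remainder c (X i * monomial σ 1)) := by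
  rcases eq_or_ne i j with rfl | hij
  · rfl
  have hX : ∀ k : Fin n, (X k : MvPolynomial (Fin n) A) * monomial σ 1 =
      monomial (Finsupp.single k 1 + σ) 1 := fun k => by rw [X, monomial_mul, mul_one]
  rw [hX, hX]
  have hcomm : Finsupp.single j 1 + (Finsupp.single i 1 + σ) =
      Finsupp.single i 1 + (Finsupp.single j 1 + σ) := add_left_comm _ _ _
  -- If `x_k σ ∈ O` and `x_l σ ∈ ∂O`, then `x_k x_l σ` is again a border term, since `x_l σ` divides
  -- it. It forms a neighbour couple of the first kind with `x_l σ`, so the error term vanishes.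
  have mixed : ∀ k l : Fin n, Finsupp.single k 1 + σ ∈ O →
      ∀ hl : Finsupp.single l 1 + σ ∈ border O,
        remainder c (X k * ofCoeffs c ⟨_, hl⟩) = 0 := fun k l hk hl => by
    have hb : Finsupp.single k 1 + (Finsupp.single l 1 + σ) ∈ border O := by
      rw [add_left_comm]
      refine (single_add_mem hk l).resolve_left fun hmem => ?_
      refine notMem_of_mem_border hl (hO _ _ hmem ?_)
      rw [add_left_comm]
      exact le_add_self
    exact h.remainder_X_mul_single (r := ⟨_, hb⟩) (s := ⟨_, hl⟩) rfl
  rcases single_add_mem hσ i with ha | ha <;> rcases single_add_mem hσ j with hb | hb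
  · rw [remainder_X_mul_remainder_of_mem ha, remainder_X_mul_remainder_of_mem hb, hcomm]
  · have h2 := remainder_X_mul_remainder_of_border (c := c) ⟨_, hb⟩ i
    rw [mixed i j ha hb, sub_zero] at h2
    rw [remainder_X_mul_remainder_of_mem ha, hcomm]
    exact h2
  · have h2 := remainder_X_mul_remainder_of_border (c := c) ⟨_, ha⟩ j
    rw [mixed j i hb ha, sub_zero] at h2
    rw [remainder_X_mul_remainder_of_mem hb, ← hcomm]
    exact h2.symm
  -- Both products lie in the border and form a neighbour couple of the second kind, so the two
  -- error terms agree.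
  · have h1 := remainder_X_mul_remainder_of_border (c := c) ⟨_, ha⟩ j
    have h2 := remainder_X_mul_remainder_of_border (c := c) ⟨_, hb⟩ i
    rw [h.remainder_X_mul_eq (r := ⟨_, ha⟩) (s := ⟨_, hb⟩) hij.symm hcomm] at h1
    refine h2.trans (Eq.trans ?_ h1.symm)
    rw [hcomm]

/-- Multiplication by a variable followed by taking the remainder, on the span of `O`. -/
noncomputable def mulVar (c : border O × O → A) (i : Fin n) :
    Module.End A (termSpan A (O : Set (Term n))) :=
  ((remainder c) ∘ₗ (LinearMap.mulLeft A (X i))).restrict fun _ hp =>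
    remainder_mem c (X_mul_mem_borderSpan i hp)

lemma coe_mulVar (i : Fin n) (p : termSpan A (O : Set (Term n))) :
    (mulVar c i p : MvPolynomial (Fin n) A) = remainder c (X i * (p : MvPolynomial (Fin n) A)) := rfl

lemma NeighboursVanish.mulVar_comm (h : NeighboursVanish c)
    (hO : IsOrderIdeal (O : Set (Term n))) (i j : Fin n) :
    mulVar c i * mulVar c j = mulVar c j * mulVar c i := by
  ext1 ⟨p, hp⟩
  refine Subtype.ext ?_
  simp only [Module.End.mul_apply, coe_mulVar]
  induction hp using Submodule.span_induction with
  | mem x hx =>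
    obtain ⟨σ, hσ, rfl⟩ := hx
    exact h.comm_monomial hO hσ i j
  | zero => simp
  | add x y _ _ hx hy => simp only [mul_add, map_add, hx, hy]
  | smul a x _ hx => simp only [mul_smul_comm, map_smul, hx]

/-- A linear retraction of the polynomial ring onto the span of `O` that kills the ideal of the
marked set. -/
lemma NeighboursVanish.exists_retraction (h : NeighboursVanish c)
    (hO : IsOrderIdeal (O : Set (Term n))) (h0 : (0 : Term n) ∈ O) :
    ∃ ψ : MvPolynomial (Fin n) A →ₗ[A] termSpan A (O : Set (Term n)),
      (∀ p ∈ termSpan A (O : Set (Term n)), (ψ p : MvPolynomial (Fin n) A) = p) ∧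
      ∀ p ∈ Ideal.span (Set.range (ofCoeffs c)), ψ p = 0 := by
  obtain ⟨ψ, h1, hX⟩ := exists_equivariant (mulVar c) (h.mulVar_comm hO)
    ⟨1, monomial_mem_termSpan (A := A) (T := (O : Set (Term n))) h0 1⟩
  have hmono : ∀ σ : Term n, σ ∈ O → (ψ (monomial σ 1) : MvPolynomial (Fin n) A) = monomial σ 1 := by
    intro σ
    induction σ using term_induction with
    | zero =>
      intro _
      exact congrArg Subtype.val h1
    | step i τ ih =>
      intro hσ
      have hτ := ih (hO τ _ hσ le_add_self)
      have hs : (monomial (Finsupp.single i 1 + τ) 1 : MvPolynomial (Fin n) A) =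
          X i * monomial τ 1 := by rw [X, monomial_mul, mul_one]
      rw [hs, hX, coe_mulVar, hτ, ← hs]
      exact remainder_of_mem c (monomial_mem_termSpan (T := (O : Set (Term n))) hσ 1)
  have hspan : ∀ p ∈ termSpan A (O : Set (Term n)), (ψ p : MvPolynomial (Fin n) A) = p := by
    intro p hp
    induction hp using Submodule.span_induction with
    | mem x hx =>
      obtain ⟨σ, hσ, rfl⟩ := hx
      exact hmono σ hσ
    | zero => simp
    | add x y _ _ hx hy => rw [map_add, Submodule.coe_add, hx, hy]
    | smul a x _ hx => rw [map_smul, Submodule.coe_smul, hx]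
  -- Write `τ = x_i σ` with `σ ∈ O`. By equivariance `ψ τ` is the remainder of `τ`, namely `τ -
  -- f_τ`; this lies in `⟨O⟩` and is fixed by `ψ`.
  have hF : ∀ τ : border O, ψ (ofCoeffs c τ) = 0 := by
    intro τ
    obtain ⟨i, σ, hσ, hτ⟩ := exists_eq_single_add_of_mem_border τ.2
    refine Subtype.ext ?_
    have hs : (monomial (τ : Term n) 1 : MvPolynomial (Fin n) A) = X i * monomial σ 1 := by
      rw [X, monomial_mul, mul_one, hτ]
    have hm : (ψ (monomial (τ : Term n) 1) : MvPolynomial (Fin n) A) =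
        monomial (τ : Term n) 1 - ofCoeffs c τ := by
      rw [hs, hX, coe_mulVar, hmono σ hσ, ← hs, remainder_monomial_border]
    have ht : monomial (τ : Term n) 1 - ofCoeffs c τ ∈ termSpan A (O : Set (Term n)) := by
      rw [ofCoeffs, sub_sub_cancel]
      exact sum_monomial_mem_termSpan _
    have h3 := hspan _ ht
    rw [map_sub, AddSubgroupClass.coe_sub, hm] at h3
    simpa using h3
  refine ⟨ψ, hspan, fun p hp => ?_⟩
  induction hp using Submodule.span_induction with
  | mem x hx =>
    obtain ⟨τ, rfl⟩ := hx
    exact hF τ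
  | zero => simp
  | add x y _ _ hx hy => rw [map_add, hx, hy, add_zero]
  | smul a x _ hx =>
    rw [smul_eq_mul]
    -- Equivariance makes the kernel of `ψ` stable under each variable, hence an ideal.
    induction a using MvPolynomial.induction_on with
    | C a => rw [← smul_eq_C_mul, map_smul, hx, smul_zero]
    | add p q hp hq => rw [add_mul, map_add, hp, hq, add_zero]
    | mul_X p i hp => rw [mul_right_comm, mul_comm, hX, hp, map_zero]

/-- If a term is `f + p` with `f ∈ (F)` and `p ∈ ⟨O⟩`, then `x_i p` has support in `O ∪ ∂O` and is
congruent modulo `(F)` to its remainder in `⟨O⟩`. No condition on `c` enters. -/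
lemma span_sup_termSpan (h0 : (0 : Term n) ∈ O)
    (c : border O × O → A) :
    (Ideal.span (Set.range (ofCoeffs c))).restrictScalars A ⊔
      termSpan A (O : Set (Term n)) = ⊤ := by
  have hmono : ∀ γ : Term n, monomial γ (1 : A) ∈
      (Ideal.span (Set.range (ofCoeffs c))).restrictScalars A ⊔
        termSpan A (O : Set (Term n)) := by
    intro γ
    induction γ using term_induction with
    | zero => exact Submodule.mem_sup_right (monomial_mem_termSpan h0 1)
    | step i τ ih =>
      obtain ⟨f, hf, p, hp, hfp⟩ := Submodule.mem_sup.1 ih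
      have hs : (monomial (Finsupp.single i 1 + τ) 1 : MvPolynomial (Fin n) A) =
          (X i * f + (X i * p - remainder c (X i * p))) + remainder c (X i * p) := by
        rw [add_assoc, sub_add_cancel, ← mul_add, hfp, X, monomial_mul, mul_one]
      rw [hs]
      exact Submodule.add_mem_sup
        (add_mem (Ideal.mul_mem_left _ _ hf) (sub_remainder_mem c _))
        (remainder_mem c (X_mul_mem_borderSpan i hp))
  rw [eq_top_iff, ← termSpan_univ, termSpan, Submodule.span_le]
  rintro _ ⟨γ, -, rfl⟩
  exact hmono γ

lemma NeighboursVanish.isCompl (h : NeighboursVanish c) (hO : IsOrderIdeal (O : Set (Term n))) :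
    IsCompl ((Ideal.span (Set.range (ofCoeffs c))).restrictScalars A)
      (termSpan A (termsOfIdeal (border O))ᶜ) := by
  rcases O.eq_empty_or_nonempty with rfl | ⟨σ, hσ⟩
  -- For empty `O` the ideal is zero and the complementary span is all of `A[x]`.
  · have hb : border (∅ : Finset (Term n)) = ∅ := by simp [border]
    have h1 : (termsOfIdeal (border (∅ : Finset (Term n))))ᶜ = Set.univ := by
      rw [hb]
      ext
      simp [termsOfIdeal]
    have h2 : Set.range (ofCoeffs c) = ∅ := by
      rw [Set.range_eq_empty_iff, hb]
      infer_instance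
    rw [h1, h2, termSpan_univ, Ideal.span_empty]
    exact isCompl_bot_top
  · have h0 : (0 : Term n) ∈ O := hO 0 σ hσ zero_le
    rw [compl_termsOfIdeal_border hO h0]
    refine ⟨?_, codisjoint_iff.2 (span_sup_termSpan h0 c)⟩
    obtain ⟨ψ, h1, h2⟩ := h.exists_retraction hO h0
    rw [Submodule.disjoint_def]
    intro p hp hp'
    rw [← h1 p hp', h2 p hp, ZeroMemClass.coe_zero]

lemma eq_zero_of_isCompl (hO : IsOrderIdeal (O : Set (Term n)))
    {I : Ideal (MvPolynomial (Fin n) A)}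
    (h : IsCompl (I.restrictScalars A) (termSpan A (termsOfIdeal (border O))ᶜ))
    {p : MvPolynomial (Fin n) A} (hI : p ∈ I) (hp : p ∈ termSpan A (O : Set (Term n))) : p = 0 :=
  Submodule.disjoint_def.1 h.disjoint p hI
    (termSpan_mono (subset_compl_termsOfIdeal_border hO) hp)

lemma neighboursVanish_of_isCompl (hO : IsOrderIdeal (O : Set (Term n)))
    (h : IsCompl ((Ideal.span (Set.range (ofCoeffs c))).restrictScalars A)
      (termSpan A (termsOfIdeal (border O))ᶜ)) : NeighboursVanish c := by
  intro r s hrs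
  refine eq_zero_of_isCompl hO h ?_ (remainder_mem c (sPoly_mem_borderSpan c hrs))
  have := sub_mem (sPoly_mem_span c r s) (sub_remainder_mem c
    (sPoly (r : Term n) (s : Term n) (ofCoeffs c r) (ofCoeffs c s)))
  rwa [sub_sub_cancel] at this

/-- The heads cancel in `f_τ - f'_τ`, leaving an element of `I ∩ ⟨O⟩ = 0`. Thus the ideal determines
the coefficients of its marked basis. -/
lemma ofCoeffs_injective_of_isCompl (hO : IsOrderIdeal (O : Set (Term n)))
    {c d : border O × O → A} {I : Ideal (MvPolynomial (Fin n) A)}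
    (h : IsCompl (I.restrictScalars A) (termSpan A (termsOfIdeal (border O))ᶜ))
    (hc : ∀ τ, ofCoeffs c τ ∈ I) (hd : ∀ τ, ofCoeffs d τ ∈ I) : c = d := by
  funext ⟨τ, σ⟩
  have h1 : ofCoeffs c τ - ofCoeffs d τ = 0 := by
    refine eq_zero_of_isCompl hO h (sub_mem (hc τ) (hd τ)) ?_
    rw [ofCoeffs, ofCoeffs, sub_sub_sub_cancel_left]
    exact sub_mem (sum_monomial_mem_termSpan _) (sum_monomial_mem_termSpan _)
  have h2 := congrArg (coeff (σ : Term n)) (sub_eq_zero.1 h1)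
  rwa [coeff_ofCoeffs, coeff_ofCoeffs, neg_inj] at h2

end Criterion

/-! ### Marked sets as families of coefficients -/

section Structure

variable {n m : ℕ} {O : Finset (Term n)} (hO : IsOrderIdeal (O : Set (Term n)))
  (β : Fin m ≃ border O) {A : Type*} [CommRing A]

lemma isMarkedSet_ofCoeffs (c : border O × O → A) :
    IsMarkedSet (borderRS O hO β) (ofCoeffs c) := by
  intro τ
  refine ⟨by simpa using coeff_ofCoeffs_border c τ τ, fun γ hγ hne => ?_⟩
  by_contra hγO
  refine mem_support_iff.1 hγ ?_
  rw [ofCoeffs, coeff_sub, coeff_monomial, if_neg (Ne.symm hne),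
    mem_termSpan_iff.1 (sum_monomial_mem_termSpan _) _ hγO, sub_zero]

lemma IsMarkedSet.eq_ofCoeffs {F : border O → MvPolynomial (Fin n) A}
    (h : IsMarkedSet (borderRS O hO β) F) :
    F = ofCoeffs fun x => -coeff (x.2 : Term n) (F x.1) := by
  funext τ
  ext γ
  by_cases hγ : γ ∈ O
  · have := coeff_ofCoeffs (fun x : border O × O => -coeff (x.2 : Term n) (F x.1)) τ ⟨γ, hγ⟩
    rw [this, neg_neg]
  · rw [ofCoeffs, coeff_sub, mem_termSpan_iff.1 (sum_monomial_mem_termSpan _) _ hγ, sub_zero,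
      coeff_monomial]
    split_ifs with hne
    · exact hne ▸ (h τ).1
    · by_contra hcoeff
      exact hγ ((h τ).2 γ (mem_support_iff.2 hcoeff) (Ne.symm hne))

/-- The border basis criterion: it suffices to reduce the `S`-polynomials of neighbours. -/
lemma isMarkedBasis_ofCoeffs_iff {c : border O × O → A} :
    IsMarkedBasis (borderRS O hO β) (ofCoeffs c) ↔ NeighboursVanish c :=
  ⟨fun h => neighboursVanish_of_isCompl hO h.2,
    fun h => ⟨isMarkedSet_ofCoeffs hO β c, h.isCompl hO⟩⟩

end Structure

/-! ### Reduction steps and the uniqueness of reduced forms -/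

section Reduction

variable {n m : ℕ} {O : Finset (Term n)} (hO : IsOrderIdeal (O : Set (Term n)))
  (β : Fin m ≃ border O) {A : Type*} [CommRing A]

lemma degree_lt_of_lt {γ δ : Term n} (h : γ < δ) : Finsupp.degree γ < Finsupp.degree δ := by
  have hne : δ - γ ≠ 0 := fun h0 => h.not_ge (tsub_eq_zero_iff_le.1 h0)
  rw [← add_tsub_cancel_of_le h.le, map_add]
  have := mt (Finsupp.degree_eq_zero_iff (δ - γ)).1 hne
  omega

/-- Border terms may divide one another, but one with a later label has at least the degree of `τ`,
so it divides `τ` only if equal to it. -/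
lemma zero_mem_mult (hβ : Monotone fun i : Fin m => Finsupp.degree (β i : Term n))
    (τ : border O) : (0 : Term n) ∈ (borderRS O hO β).mult τ := by
  intro j hj hle
  rw [add_zero] at hle
  have hdeg := hβ hj.le
  simp only [Equiv.apply_symm_apply] at hdeg
  rcases hle.eq_or_lt with h | h
  · refine hj.ne ?_
    rw [← Subtype.ext h, Equiv.symm_apply_apply]
  · exact (degree_lt_of_lt h).not_ge hdeg

/-- A border term lies in the cone of no border term but itself. -/
lemma eq_zero_of_mem_mult (hβ : Monotone fun i : Fin m => Finsupp.degree (β i : Term n))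
    {τ : border O} {η : Term n} (hη : η ∈ (borderRS O hO β).mult τ)
    (h : η + (τ : Term n) ∈ border O) : η = 0 := by
  -- A later label for `ητ` would contradict multiplicativity, as `ητ` divides itself. Hence
  -- `deg(ητ) ≤ deg τ`, which forces `η = 1`.
  have hle : β.symm ⟨_, h⟩ ≤ β.symm τ := by
    by_contra hlt
    refine hη _ (not_le.1 hlt) ?_
    rw [Equiv.apply_symm_apply]
    exact (add_comm _ _).le
  have hdeg := hβ hle
  simp only [Equiv.apply_symm_apply, map_add] at hdeg
  exact (Finsupp.degree_eq_zero_iff η).1 (by omega)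

lemma reductionStep_iff (hβ : Monotone fun i : Fin m => Finsupp.degree (β i : Term n))
    (c : border O × O → A) {g h : MvPolynomial (Fin n) A} (hg : g ∈ borderSpan O A) :
    ReductionStep (borderRS O hO β) (ofCoeffs c) g h ↔
      ∃ τ : border O, coeff (τ : Term n) g ≠ 0 ∧
        h = g - coeff (τ : Term n) g • ofCoeffs c τ := by
  constructor
  · rintro ⟨τ, η, hη, hsupp, rfl⟩
    have hmem : η + (τ : Term n) ∈ border O := by
      by_contra hb
      refine mem_support_iff.1 hsupp (mem_termSpan_iff.1 hg _ ?_)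
      rintro (h | h)
      · exact notMem_of_mem_border τ.2 (hO _ _ h le_add_self)
      · exact hb h
    obtain rfl := eq_zero_of_mem_mult hO β hβ hη hmem
    rw [zero_add] at hsupp
    refine ⟨τ, mem_support_iff.1 hsupp, ?_⟩
    rw [zero_add, smul_eq_C_mul]
    rfl
  · rintro ⟨τ, hτ, rfl⟩
    refine ⟨τ, 0, zero_mem_mult hO β hβ τ, ?_, ?_⟩
    · rw [zero_add]
      exact mem_support_iff.2 hτ
    · rw [zero_add, smul_eq_C_mul]
      rfl

/-- Each step subtracts a multiple of some `f_τ`, which `remainder` kills. This invariance gives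
uniqueness, an `O`-reduced polynomial being its own remainder. -/
lemma Reduces.remainder_eq (hβ : Monotone fun i : Fin m => Finsupp.degree (β i : Term n))
    {c : border O × O → A} {g h : MvPolynomial (Fin n) A}
    (hgh : Reduces (borderRS O hO β) (ofCoeffs c) g h) (hg : g ∈ borderSpan O A) :
    h ∈ borderSpan O A ∧ remainder c h = remainder c g := by
  induction hgh with
  | refl => exact ⟨hg, rfl⟩
  | tail _ hstep ih =>
    obtain ⟨τ, -, rfl⟩ := (reductionStep_iff hO β hβ c ih.1).1 hstep
    refine ⟨sub_mem ih.1 (Submodule.smul_mem _ _ (ofCoeffs_mem_borderSpan c τ)), ?_⟩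
    rw [map_sub, map_smul, remainder_ofCoeffs, smul_zero, sub_zero, ih.2]

lemma reduces_remainder (hβ : Monotone fun i : Fin m => Finsupp.degree (β i : Term n))
    (c : border O × O → A) {g : MvPolynomial (Fin n) A} (hg : g ∈ borderSpan O A) :
    Reduces (borderRS O hO β) (ofCoeffs c) g (remainder c g) := by
  classical
  rw [remainder_apply]
  -- Border terms are eliminated one by one; earlier eliminations leave the next coefficient as it
  -- was in `g`, and a zero coefficient requires no step.
  generalize (Finset.univ : Finset (border O)) = s
  induction s using Finset.induction_on with
  | empty =>
    rw [Finset.sum_empty, sub_zero]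
    exact Relation.ReflTransGen.refl
  | insert τ s hτ ih =>
    rw [Finset.sum_insert hτ, add_comm, ← sub_sub]
    have hcoeff : coeff (τ : Term n)
        (g - ∑ ρ ∈ s, coeff (ρ : Term n) g • ofCoeffs c ρ) = coeff (τ : Term n) g := by
      rw [coeff_sub, coeff_sum, Finset.sum_eq_zero, sub_zero]
      intro ρ hρ
      rw [coeff_smul, coeff_ofCoeffs_border, if_neg (ne_of_mem_of_not_mem hρ hτ), smul_zero]
    by_cases h0 : coeff (τ : Term n) g = 0
    · rwa [h0, zero_smul, sub_zero]
    · refine ih.tail ((reductionStep_iff hO β hβ c ?_).2 ⟨τ, by rwa [hcoeff], by rw [hcoeff]⟩)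
      exact sub_mem hg (Submodule.sum_mem _ fun ρ _ =>
        Submodule.smul_mem _ _ (ofCoeffs_mem_borderSpan c ρ))

/-- The remainder is the unique `O`-reduced polynomial to which a polynomial with support in
`O ∪ ∂O` reduces. -/
lemma reduces_and_isReduced_iff (hβ : Monotone fun i : Fin m => Finsupp.degree (β i : Term n))
    (c : border O × O → A) {g h : MvPolynomial (Fin n) A} (hg : g ∈ borderSpan O A) :
    Reduces (borderRS O hO β) (ofCoeffs c) g h ∧ IsReduced O h ↔ h = remainder c g := by
  constructor
  · rintro ⟨hgh, hh⟩
    rw [← (hgh.remainder_eq hO β hβ hg).2,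
      remainder_of_mem c (isReduced_iff_mem_termSpan.1 hh)]
  · rintro rfl
    exact ⟨reduces_remainder hO β hβ c hg, isReduced_iff_mem_termSpan.2 (remainder_mem c hg)⟩

lemma genericMarkedSet_eq_ofCoeffs (K : Type*) [Field K] :
    genericMarkedSet K (border O) O = ofCoeffs (X : border O × O → MvPolynomial (border O × O) K) :=
  rfl

/-- A specialization of the generic coefficients kills the ideal of the border scheme exactly when
the `S`-polynomials of the neighbour couples of the specialized marked set have remainder zero. -/
lemma borderIdeal_le_ker_iff (hβ : Monotone fun i : Fin m => Finsupp.degree (β i : Term n))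
    {K : Type*} [Field K] (φ : MvPolynomial (border O × O) K →+* A) :
    borderIdeal K O hO β ≤ RingHom.ker φ ↔ NeighboursVanish fun x => φ (X x) := by
  rw [borderIdeal, Ideal.span_le]
  have hmap : ∀ r s : border O, map φ (remainder X (sPoly (r : Term n) (s : Term n)
      (ofCoeffs (X : border O × O → MvPolynomial (border O × O) K) r) (ofCoeffs X s))) =
      remainder (fun x => φ (X x)) (sPoly (r : Term n) (s : Term n)
        (ofCoeffs (fun x => φ (X x)) r) (ofCoeffs (fun x => φ (X x)) s)) := fun r s => by
    rw [map_remainder, map_sPoly, map_ofCoeffs, map_ofCoeffs]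
  constructor
  · intro h r s hrs
    rw [← hmap]
    ext γ
    rw [coeff_map, coeff_zero]
    refine h ⟨r, s, hrs, _, ?_, ?_, γ, rfl⟩
    · exact ((reduces_and_isReduced_iff hO β hβ _ (sPoly_mem_borderSpan _ hrs)).2 rfl).1
    · exact ((reduces_and_isReduced_iff hO β hβ _ (sPoly_mem_borderSpan _ hrs)).2 rfl).2
  · rintro h _ ⟨r, s, hrs, p, hp, hp', γ, rfl⟩
    rw [genericMarkedSet_eq_ofCoeffs] at hp
    obtain rfl := (reduces_and_isReduced_iff hO β hβ _ (sPoly_mem_borderSpan _ hrs)).1 ⟨hp, hp'⟩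
    rw [SetLike.mem_coe, RingHom.mem_ker, ← coeff_map, hmap, h r s hrs, coeff_zero]

end Reduction

/-! ### The universal marked basis and the functor of points -/

section Representability

variable {n m : ℕ} {O : Finset (Term n)} (hO : IsOrderIdeal (O : Set (Term n)))
  (β : Fin m ≃ border O) (K : Type u) [Field K]

/-- The coordinate ring of the border scheme. -/
abbrev BorderRing : Type u := MvPolynomial (border O × O) K ⧸ borderIdeal K O hO β

/-- The generic coefficients in the coordinate ring of the border scheme. -/
noncomputable def universalCoeffs (x : border O × O) : BorderRing hO β K :=
  Ideal.Quotient.mk (borderIdeal K O hO β) (X x)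

lemma neighboursVanish_universalCoeffs
    (hβ : Monotone fun i : Fin m => Finsupp.degree (β i : Term n)) : NeighboursVanish (universalCoeffs hO β K) :=
  (borderIdeal_le_ker_iff hO β hβ (Ideal.Quotient.mk (borderIdeal K O hO β))).1
    Ideal.mk_ker.ge

/-- The ideal of the universal border marked basis. -/
noncomputable def universalIdeal
    (hβ : Monotone fun i : Fin m => Finsupp.degree (β i : Term n)) : MarkedBasisIdeals (borderRS O hO β) (BorderRing hO β K) :=
  ⟨Ideal.span (Set.range (ofCoeffs (universalCoeffs hO β K))), _,
    (isMarkedBasis_ofCoeffs_iff hO β).2 (neighboursVanish_universalCoeffs hO β K hβ), rfl⟩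

lemma extend_universalIdeal (hβ : Monotone fun i : Fin m => Finsupp.degree (β i : Term n))
    {A : Type u} [CommRing A] (φ : BorderRing hO β K →+* A) :
    (MarkedBasisIdeals.extend φ (universalIdeal hO β K hβ)).1 =
      Ideal.span (Set.range (ofCoeffs fun x => φ (universalCoeffs hO β K x))) := by
  change (Ideal.span (Set.range (ofCoeffs (universalCoeffs hO β K)))).map (map φ) = _
  rw [map_span_range (J := borderRS O hO β)]
  congr 2
  funext τ
  exact map_ofCoeffs φ _ τ

/-- The universal ideal represents the marked basis functor on `K`-algebras. -/
lemma bijective_extend_universalIdeal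
    (hβ : Monotone fun i : Fin m => Finsupp.degree (β i : Term n))
    {A : Type u} [CommRing A] [Algebra K A] :
    Function.Bijective fun φ : BorderRing hO β K →ₐ[K] A =>
      MarkedBasisIdeals.extend (φ : BorderRing hO β K →+* A) (universalIdeal hO β K hβ) := by
  constructor
  · intro φ ψ h
    have hφ := extend_universalIdeal hO β K hβ (φ : BorderRing hO β K →+* A)
    have hψ := extend_universalIdeal hO β K hβ (ψ : BorderRing hO β K →+* A)
    have hI := congrArg Subtype.val h
    -- The direct sum persists under extension along `φ`. Both specialized marked sets lie in this
    -- one extended ideal, so their coefficients coincide.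
    have hcompl := isCompl_map (φ : BorderRing hO β K →+* A) _ _
      ((neighboursVanish_universalCoeffs hO β K hβ).isCompl hO)
    have key := ofCoeffs_injective_of_isCompl hO (I := Ideal.map (map (φ : BorderRing hO β K →+* A))
      (Ideal.span (Set.range (ofCoeffs (universalCoeffs hO β K))))) hcompl
      (c := fun x => φ (universalCoeffs hO β K x)) (d := fun x => ψ (universalCoeffs hO β K x))
      (fun τ => hφ.ge (Ideal.subset_span ⟨τ, rfl⟩))
      (fun τ => hI.ge (hψ.ge (Ideal.subset_span ⟨τ, rfl⟩)))
    refine Ideal.Quotient.algHom_ext _ (MvPolynomial.algHom_ext fun x => ?_)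
    exact congrFun key x
  · rintro ⟨I, F, hF, rfl⟩
    obtain ⟨c, rfl⟩ : ∃ c, F = ofCoeffs c := ⟨_, hF.1.eq_ofCoeffs hO β⟩
    have hker : borderIdeal K O hO β ≤ RingHom.ker
        ((aeval c : MvPolynomial (border O × O) K →ₐ[K] A) :
          MvPolynomial (border O × O) K →+* A) := by
      rw [borderIdeal_le_ker_iff hO β hβ]
      have := (isMarkedBasis_ofCoeffs_iff hO β).1 hF
      simpa using this
    refine ⟨Ideal.Quotient.liftₐ _ (aeval c) fun a ha => hker ha, Subtype.ext ?_⟩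
    refine (extend_universalIdeal hO β K hβ _).trans ?_
    congr 3
    funext x
    exact aeval_X c x

lemma MarkedBasisIdeals.extend_comp {J : ReductionStructure n} {A B C : Type u} [CommRing A]
    [CommRing B] [CommRing C] (φ : A →+* B) (ψ : B →+* C) (I : MarkedBasisIdeals J A) :
    MarkedBasisIdeals.extend (ψ.comp φ) I =
      MarkedBasisIdeals.extend ψ (MarkedBasisIdeals.extend φ I) :=
  Subtype.ext (ideal_map_comp φ ψ I.1)

/-- Points of the border scheme over `Spec A` are algebra maps out of the coordinate ring. -/
noncomputable def pointsEquiv (A : NoethAlg K) :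
    (functorOfPoints K (borderMarkedScheme K O hO β)).obj A ≃ (BorderRing hO β K →ₐ[K] A.obj) where
  toFun f := ((AlgebraicGeometry.algSpec.fullyFaithful (R := CommRingCat.of K)).preimage f).unop.hom
  invFun φ := (AlgebraicGeometry.algSpec (CommRingCat.of K)).map (CommAlgCat.ofHom φ).op
  left_inv f := (AlgebraicGeometry.algSpec.fullyFaithful (R := CommRingCat.of K)).map_preimage f
  right_inv φ := by
    have := (AlgebraicGeometry.algSpec.fullyFaithful (R := CommRingCat.of K)).preimage_map
      (CommAlgCat.ofHom φ).op
    exact congrArg (fun g => g.unop.hom) this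

lemma pointsEquiv_map {A B : NoethAlg K} (f : A ⟶ B)
    (x : (functorOfPoints K (borderMarkedScheme K O hO β)).obj A) :
    pointsEquiv hO β K B ((functorOfPoints K (borderMarkedScheme K O hO β)).map f x) =
      f.hom.hom.comp (pointsEquiv hO β K A x) := by
  -- Once the point is written as the spectrum of an algebra map, naturality is functoriality of
  -- `algSpec`.
  obtain ⟨φ, rfl⟩ := (pointsEquiv hO β K A).symm.surjective x
  rw [Equiv.apply_symm_apply, ← Equiv.eq_symm_apply]
  exact ((AlgebraicGeometry.algSpec (CommRingCat.of K)).map_comp f.hom.op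
    (CommAlgCat.ofHom φ).op).symm

/-- The border scheme represents the border marked basis functor. -/
noncomputable def markedBasisFunctorIso
    (hβ : Monotone fun i : Fin m => Finsupp.degree (β i : Term n)) :
    functorOfPoints K (borderMarkedScheme K O hO β) ≅ markedBasisFunctor K (borderRS O hO β) :=
  NatIso.ofComponents
    (fun A => ((pointsEquiv hO β K A).trans
      (Equiv.ofBijective _ (bijective_extend_universalIdeal hO β K hβ))).toIso)
    fun {A B} f => by
      refine ConcreteCategory.hom_ext _ _ fun x => ?_
      change MarkedBasisIdeals.extend _ _ = MarkedBasisIdeals.extend _ (MarkedBasisIdeals.extend _ _)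
      rw [← MarkedBasisIdeals.extend_comp]
      congr 1
      exact congrArg (fun φ : BorderRing hO β K →ₐ[K] B.obj => (φ : BorderRing hO β K →+* B.obj))
        (pointsEquiv_map hO β K f x)

end Representability

end MarkedBases

/-- Let `O` be a finite order ideal, the terms of its border being labelled increasingly by degree.
The `S`-polynomial of every neighbour couple of the generic border marked set reduces to exactly
one `O`-reduced polynomial, and the functor of ideals generated by border marked bases is the
functor of points of `Spec (K[C] / 𝔅)`, where `𝔅` is generated by the `x`-coefficients of these
reductions. -/
theorem theorem3p4 (K : Type u) [Field K] (n m : ℕ) (O : Finset (MarkedBases.Term n))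
    (hO : MarkedBases.IsOrderIdeal (O : Set (MarkedBases.Term n)))
    (β : Fin m ≃ MarkedBases.border O)
    (hβ : Monotone fun i : Fin m => Finsupp.degree (β i : MarkedBases.Term n)) :
    (∀ r s : MarkedBases.border O,
      MarkedBases.IsNeighbour (r : MarkedBases.Term n) (s : MarkedBases.Term n) →
      ∃! h, MarkedBases.Reduces (MarkedBases.borderRS O hO β)
          (MarkedBases.genericMarkedSet K (MarkedBases.border O) O)
          (MarkedBases.sPoly (r : MarkedBases.Term n) (s : MarkedBases.Term n)
            (MarkedBases.genericMarkedSet K (MarkedBases.border O) O r)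
            (MarkedBases.genericMarkedSet K (MarkedBases.border O) O s)) h ∧
        MarkedBases.IsReduced O h) ∧
    Nonempty (MarkedBases.markedBasisFunctor K (MarkedBases.borderRS O hO β) ≅
      MarkedBases.functorOfPoints K (MarkedBases.borderMarkedScheme K O hO β)) := by
  refine ⟨fun r s hrs => ?_, ⟨(MarkedBases.markedBasisFunctorIso hO β K hβ).symm⟩⟩
  rw [MarkedBases.genericMarkedSet_eq_ofCoeffs]
  simp only [MarkedBases.reduces_and_isReduced_iff hO β hβ _
    (MarkedBases.sPoly_mem_borderSpan _ hrs)]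
  exact ⟨_, rfl, fun _ h => h⟩
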